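/- Let $\mathfrak c=2^{\aleph_0}$. Fix a partition $\{P_0,P_1\}$ of $\mathfrak c$ (the set of ordinals below $\mathfrak c$) with $|P_0|=|P_1|=\mathfrak c$ and $\omega+1\subseteq P_1$, a partition $\{R_0,R_1\}$ of $2^{\mathfrak c}\setminus\mathfrak c$ with $|R_0|=|R_1|=2^{\mathfrak c}$, a partition $\{C_{n,m}: n>1,\ m\ge 1\}$ of $P_0$ into sets of cardinality $\mathfrak c$, and a set $C_1\subseteq P_1$ with $\omega\subseteq C_1$ and $|C_1|=|P_1\setminus C_1|=\mathfrak c$. For a set $I$ and an Abelian group $G$, $G^{(I)}$ denotes the group of finitely supported functions $I\to G$. Let $$\mathbf X=\bigoplus_{n>1,\,m\ge 1}(\mathbb Q/\mathbb Z)^{(C_{n,m}\times m)}\oplus\mathbb Q^{(P_1)}\oplus(\mathbb Q/\mathbb Z)^{(R_0)}\oplus\mathbb Q^{(R_1)},$$ where $m=\{0,\dots,m-1\}$. For $\mu\in P_1$ let $\chi_\mu\in\mathbf X$ be the element whose $\mu$-th coordinate is $1$ and whose other coordinates are $0$. For $\mu\in P_0$ and $n\ge 1$ let $[\frac1n\chi_{(\mu,0)}]\in\mathbf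 X$ be the element whose $(\mu,0)$-th coordinate is $\frac1n+\mathbb Z$ and whose other coordinates are $0$. For an Abelian group $G$ let $r(G)$ be its free rank, $G[n]=\{x\in G: nx=0\}$, and let $D_G$ be the set of all integers $n>1$ such that $G$ contains an isomorphic copy of $\mathbb Z_n^{(\mathfrak c)}$. A subgroup $L$ of $\mathbf X$ is called large if $2^{\mathfrak c}\ge|L|\ge r(L)\ge\mathfrak c$, for all positive integers $d\mid n$ the group $dL[n]$ is either finite or of cardinality at least $\mathfrak c$, and there are positive integers $k_n$ $(n\in D_L)$ such that $\chi_\mu\in L$ for all $\mu\in C_1$ and $[\frac1n\chi_{(\mu,0)}]\in L$ for all $n\in D_L$ and $\mu\in C_{n,k_n}$. Let $H$ be an Abelian group with $2^{\mathfrak c}\ge|H|\ge r(H)\ge\mathfrak c$. Then there are positive integers $k_n$ $(n\in D_H)$ and a group monomorphism $\varphi:H\to\mathbf X$ such that i) $\chi_\mu\in\varphi[H]$ for all $\mu\in C_1$, and ii) $[\frac1n\chi_{(\mu,0)}]\in\varphi[H]$ for all $n\in D_H$ and $\mu\in C_{n,k_n}$. Consequently, if moreover for all positive integers $d\mid n$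 the group $dH[n]$ is either finite or of cardinality at least $\mathfrak c$, then $H$ is isomorphic to a large subgroup of $\mathbf X$. -/

import Mathlib

open Cardinal

universe u

/-- The fixed combinatorial data: a partition `{P₀, P₁}` of `𝔠`, a partition `{R₀, R₁}` of
`2 ^ 𝔠 \ 𝔠`, a partition `{C n m : n > 1, m ≥ 1}` of `P₀` into pieces of cardinality `𝔠`, and a set
`C₁ ⊆ P₁`.  The cardinals `𝔠` and `2 ^ 𝔠` are identified with the sets of ordinals below their
initial ordinals.  (The values `C n m` for `n ≤ 1` or `m = 0` are irrelevant.) -/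
structure IndexData where
  P₀ : Set Ordinal.{0}
  P₁ : Set Ordinal.{0}
  R₀ : Set Ordinal.{0}
  R₁ : Set Ordinal.{0}
  C : ℕ → ℕ → Set Ordinal.{0}
  C₁ : Set Ordinal.{0}
  P_union : P₀ ∪ P₁ = Set.Iio (continuum.{0}).ord
  P_disjoint : Disjoint P₀ P₁
  card_P₀ : #P₀ = continuum
  card_P₁ : #P₁ = continuum
  omega_succ_subset : Set.Iio (Ordinal.omega0 + 1) ⊆ P₁
  R_union : R₀ ∪ R₁ = Set.Ico (continuum.{0}).ord ((2 : Cardinal.{0}) ^ continuum.{0}).ord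
  R_disjoint : Disjoint R₀ R₁
  card_R₀ : #R₀ = 2 ^ continuum
  card_R₁ : #R₁ = 2 ^ continuum
  C_union : {μ | ∃ n m, 1 < n ∧ 1 ≤ m ∧ μ ∈ C n m} = P₀
  C_disjoint : ∀ n m n' m', 1 < n → 1 ≤ m → 1 < n' → 1 ≤ m' → (n, m) ≠ (n', m') →
    Disjoint (C n m) (C n' m')
  card_C : ∀ n m, 1 < n → 1 ≤ m → #(C n m) = continuum
  C₁_subset : C₁ ⊆ P₁
  omega_subset_C₁ : Set.Iio Ordinal.omega0 ⊆ C₁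
  card_C₁ : #C₁ = continuum
  card_P₁_diff_C₁ : #(P₁ \ C₁ : Set Ordinal.{0}) = continuum

/-- The group `ℚ / ℤ`. -/
abbrev QmodZ : Type := AddCircle (1 : ℚ)

namespace IndexData

/-- `𝕎 = (ℚ/ℤ)^(P₀ × ω) ⊕ ℚ^(P₁) ⊕ (ℚ/ℤ)^(R₀) ⊕ ℚ^(R₁)`. -/
abbrev W (S : IndexData) : Type 1 :=
  ((S.P₀ × ℕ) →₀ QmodZ) × (S.P₁ →₀ ℚ) × (S.R₀ →₀ QmodZ) × (S.R₁ →₀ ℚ)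

/-- `𝕏 = ℚ^(P₀ × ω) ⊕ ℚ^(P₁) ⊕ ℚ^(R₀) ⊕ ℚ^(R₁)`. -/
abbrev RatX (S : IndexData) : Type 1 :=
  ((S.P₀ × ℕ) →₀ ℚ) × (S.P₁ →₀ ℚ) × (S.R₀ →₀ ℚ) × (S.R₁ →₀ ℚ)

/-- The homomorphism `w ↦ [w]` from `𝕏` onto `𝕎`: it reduces the coordinates in
`(P₀ × ω) ∪ R₀` modulo `ℤ` and keeps those in `P₁ ∪ R₁`. -/
noncomputable def bracket (S : IndexData) : S.RatX →+ S.W :=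
  (Finsupp.mapRange.addMonoidHom (QuotientAddGroup.mk' (AddSubgroup.zmultiples (1 : ℚ)))).prodMap
    ((AddMonoidHom.id _).prodMap
      ((Finsupp.mapRange.addMonoidHom
        (QuotientAddGroup.mk' (AddSubgroup.zmultiples (1 : ℚ)))).prodMap
        (AddMonoidHom.id _)))

/-- `χ_μ` for `μ ∈ P₁`, as an element of `𝕏`. -/
noncomputable def chiOne (S : IndexData) (μ : S.P₁) : S.RatX :=
  (0, Finsupp.single μ 1, 0, 0)

/-- `χ_(μ,i)` for `(μ, i) ∈ P₀ × ω`, as an element of `𝕏`. -/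
noncomputable def chiZero (S : IndexData) (μ : S.P₀) (i : ℕ) : S.RatX :=
  (Finsupp.single (μ, i) 1, 0, 0, 0)

/-- The main group
`𝐗 = ⨁_{n > 1, m ≥ 1} (ℚ/ℤ)^(C n m × m) ⊕ ℚ^(P₁) ⊕ (ℚ/ℤ)^(R₀) ⊕ ℚ^(R₁)`, as the subgroup of `𝕎` of
the elements whose support within `P₀ × ω` lies in `⋃_{n > 1, m ≥ 1} C n m × {0, …, m - 1}`. -/
def X (S : IndexData) : AddSubgroup S.W where
  carrier := {w | ∀ x : S.P₀ × ℕ, w.1 x ≠ 0 →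
    ∃ n m, 1 < n ∧ 1 ≤ m ∧ (x.1 : Ordinal.{0}) ∈ S.C n m ∧ x.2 < m}
  zero_mem' := fun x hx => absurd rfl hx
  add_mem' := by
    intro a b ha hb x hx
    by_cases h : a.1 x = 0
    · refine hb x fun h' => hx ?_
      simp [h, h']
    · exact ha x h
  neg_mem' := by
    intro a ha x hx
    refine ha x fun h => hx ?_
    simp [h]

end IndexData

/-- The set `D` of all integers `n > 1` such that `G` contains an isomorphic copy of
`ℤ_n^(𝔠)` (the index set `ℝ` has cardinality `𝔠`). -/
def ordersD (G : Type u) [AddCommGroup G] : Set ℕ :=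
  {n | 1 < n ∧ ∃ f : (ℝ →₀ ZMod n) →+ G, Function.Injective f}

/-- `2 ^ 𝔠 ≥ |G| ≥ r(G) ≥ 𝔠`, where the free rank `r(G)` is the rank of `G` as a `ℤ`-module. -/
def SizeCondition (G : Type u) [AddCommGroup G] : Prop :=
  #G ≤ 2 ^ continuum ∧ Module.rank ℤ G ≤ #G ∧ continuum ≤ Module.rank ℤ G

/-- For all positive integers `d ∣ n`, the group `d G[n] = {d x : n x = 0}` is finite or of
cardinality at least `𝔠`. -/
def TorsionCondition (G : Type u) [AddCommGroup G] : Prop :=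
  ∀ d n : ℕ, 0 < d → 0 < n → d ∣ n →
    ((fun x : G => d • x) '' {x : G | n • x = 0}).Finite ∨
      continuum ≤ #((fun x : G => d • x) '' {x : G | n • x = 0})

/-- Large subgroups of `𝐗`. -/
def IndexData.IsLarge (S : IndexData) (L : AddSubgroup S.X) : Prop :=
  SizeCondition L ∧ TorsionCondition L ∧
    ∃ k : ℕ → ℕ, (∀ n ∈ ordersD L, 1 ≤ k n) ∧
      (∀ μ : S.P₁, (μ : Ordinal.{0}) ∈ S.C₁ → ∃ x ∈ L, (x : S.W) = S.bracket (S.chiOne μ)) ∧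
      (∀ n ∈ ordersD L, ∀ μ : S.P₀, (μ : Ordinal.{0}) ∈ S.C n (k n) →
        ∃ x ∈ L, (x : S.W) = S.bracket ((1 / (n : ℚ)) • S.chiZero μ 0))

universe v w

/-! All `k n` can be taken to be `1`. Choose in `H` an independent family indexed by `P₀ ⊔ P₁`:
elements of order `n` over `C n 1` for `n ∈ ordersD H`, trivial ones over the rest of `P₀`, elements
of infinite order over `P₁`. Transfinite recursion finds it (`exists_independent_family`): fewer
than `𝔠` earlier choices span a group of size below `𝔠`, which cannot meet all of `𝔠` independent
cyclic groups.

The family satisfies the same relations as the elements `1/n` and `1` of `Y = (ℚ/ℤ)^(P₀) ⊕ ℚ^(P₁)`,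
so its span embeds in `Y`. Divisibility of `Y` extends this to `g : H → Y`, whose kernel embeds in
`Z = (ℚ/ℤ)^(R₀) ⊕ ℚ^(R₁)` for reasons of size. Extending that embedding to `H` by zero on the span
makes the pair injective (`exists_injective_extension`). Finally `Y × Z` sits in `𝐗` along the
coordinates `(μ, 0)`. -/

/-! ### Divisible groups are injective -/

theorem baer_of_smul_surjective {A : Type v} [AddCommGroup A]
    (h : ∀ n : ℤ, n ≠ 0 → Function.Surjective fun a : A => n • a) : Module.Baer ℤ A :=
  letI : DivisibleBy A ℤ := divisibleByOfSMulRightSurj A ℤ fun {n} hn => h n hn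
  Module.Baer.of_divisible A

theorem Finsupp.smul_surjective {I : Type v} {A : Type w} [AddCommGroup A]
    {n : ℤ} (h : Function.Surjective fun a : A => n • a) :
    Function.Surjective fun a : I →₀ A => n • a := by
  intro f
  induction f using Finsupp.induction_linear with
  | zero => exact ⟨0, by simp⟩
  | add f g hf hg =>
    obtain ⟨a, rfl⟩ := hf
    obtain ⟨b, rfl⟩ := hg
    exact ⟨a + b, by simp⟩
  | single i x =>
    obtain ⟨y, rfl⟩ := h x
    exact ⟨Finsupp.single i y, by simp⟩

theorem QmodZ.smul_surjective {n : ℤ} (hn : n ≠ 0) :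
    Function.Surjective fun a : QmodZ => n • a := fun a =>
  ⟨DivisibleBy.div a n, DivisibleBy.div_cancel a hn⟩

theorem Rat.smul_surjective {n : ℤ} (hn : n ≠ 0) : Function.Surjective fun a : ℚ => n • a := by
  intro a
  refine ⟨a / n, ?_⟩
  have : (n : ℚ) ≠ 0 := by exact_mod_cast hn
  simp [field]

theorem baer_finsupp_qmodZ (I : Type v) : Module.Baer ℤ (I →₀ QmodZ) :=
  baer_of_smul_surjective fun _ hn => Finsupp.smul_surjective (QmodZ.smul_surjective hn)

theorem baer_finsupp_qmodZ_prod (I : Type v) (J : Type w) :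
    Module.Baer ℤ ((I →₀ QmodZ) × (J →₀ ℚ)) :=
  baer_of_smul_surjective fun _ hn => Function.Surjective.prodMap
    (Finsupp.smul_surjective (QmodZ.smul_surjective hn))
    (Finsupp.smul_surjective (Rat.smul_surjective hn))

/-! ### Independent families by transfinite recursion -/

/-- If `H` contains a copy of `ℤ_n^(𝔠)`, then every subgroup of cardinality less than `𝔠` misses
some cyclic subgroup of `H` of order `n`. -/
theorem exists_smul_mem_iff_dvd {H : Type u} [AddCommGroup H] {n : ℕ}
    (hn : ∃ f : (ℝ →₀ ZMod n) →+ H, Function.Injective f) (G : Submodule ℤ H)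
    (hG : #G < continuum) :
    ∃ e : H, n • e = 0 ∧ ∀ m : ℤ, m • e ∈ G → (n : ℤ) ∣ m := by
  obtain ⟨f, hf⟩ := hn
  have key (r : ℝ) (m : ℤ) : m • f (Finsupp.single r 1) = f (Finsupp.single r (m : ZMod n)) := by
    rw [← map_zsmul, Finsupp.smul_single, zsmul_one]
  by_contra! hcon
  have hcon' (r : ℝ) : ∃ m : ℤ, m • f (Finsupp.single r 1) ∈ G ∧ ¬ (n : ℤ) ∣ m := by
    refine hcon _ ?_
    have := key r n
    rw [natCast_zsmul] at this
    rw [this]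
    simp
  choose m hm hm' using hcon'
  refine hG.not_ge ?_
  -- The chosen multiples are nonzero and lie in different summands, hence are distinct.
  have hinj : Function.Injective fun r : ℝ => (⟨_, hm r⟩ : G) := by
    intro r s hrs
    have := congrArg Subtype.val hrs
    simp only [key] at this
    have := hf this
    rw [Finsupp.single_eq_single_iff] at this
    rcases this with h | h
    · exact h.1
    · exact absurd ((ZMod.intCast_zmod_eq_zero_iff_dvd _ _).1 h.1) (hm' r)
  have := Cardinal.mk_le_of_injective (f := fun r : ULift.{u} ℝ => (⟨_, hm r.down⟩ : G))
    (hinj.comp ULift.down_injective)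
  simpa [Cardinal.mk_real] using this

theorem mk_span_range_lt_continuum {J : Type v} {H : Type u} [AddCommGroup H] (g : J → H)
    (hJ : #J < continuum) : #(Submodule.span ℤ (Set.range g)) < continuum := by
  have h1 : Cardinal.lift.{v} #(Submodule.span ℤ (Set.range g)) ≤
      Cardinal.lift.{u} #(J →₀ ℤ) := by
    rw [← Finsupp.range_linearCombination]
    exact Cardinal.mk_range_le_lift
  have h2 : #(J →₀ ℤ) < continuum := by
    cases isEmpty_or_nonempty J
    · simpa using Cardinal.nat_lt_continuum 1
    · simpa using ⟨hJ, aleph0_lt_continuum⟩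
  rw [← Cardinal.lift_lt_continuum.{u, v}]
  exact h1.trans_lt (Cardinal.lift_lt_continuum.2 h2)

/-- Transfinite choice of an independent family with prescribed orders (`0` meaning infinite
order). -/
theorem exists_independent_family {I : Type v} {H : Type u} [AddCommGroup H] (n : I → ℕ)
    (hI : #I ≤ continuum)
    (hn : ∀ i, ∃ f : (ℝ →₀ ZMod (n i)) →+ H, Function.Injective f) :
    ∃ h : I → H, ∀ f : I →₀ ℤ,
      Finsupp.linearCombination ℤ h f = 0 ↔ ∀ i, (n i : ℤ) ∣ f i := by
  -- In a well-order of minimal type, proper initial segments have fewer than `#I ≤ 𝔠` elements.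
  obtain ⟨_, wf, hord⟩ := Cardinal.exists_ord_eq_type_lt I
  -- The bound on `G` sits inside the existential so that `E` is total and the recursion needs no
  -- size invariant; `hlt` supplies the bound afterwards.
  have step (i : I) (G : Submodule ℤ H) : ∃ e : H, #G < continuum →
      n i • e = 0 ∧ ∀ m : ℤ, m • e ∈ G → (n i : ℤ) ∣ m := by
    by_cases hG : #G < continuum
    · obtain ⟨e, he⟩ := exists_smul_mem_iff_dvd (hn i) G hG
      exact ⟨e, fun _ => he⟩
    · exact ⟨0, fun h => absurd h hG⟩
  choose E hE using step
  let h : I → H := wf.wf.fix fun i rec =>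
    E i (Submodule.span ℤ (Set.range fun j : Set.Iio i => rec j j.2))
  have h_eq (i : I) : h i = E i (Submodule.span ℤ (Set.range fun j : Set.Iio i => h j)) :=
    wf.wf.fix_eq _ i
  have hlt (i : I) : #(Submodule.span ℤ (Set.range fun j : Set.Iio i => h j)) < continuum :=
    mk_span_range_lt_continuum _ ((Cardinal.mk_Iio_lt i hord).trans_le hI)
  have h0 (i : I) (m : ℤ) (hm : (n i : ℤ) ∣ m) : m • h i = 0 := by
    obtain ⟨k, rfl⟩ := hm
    rw [mul_comm, mul_smul, natCast_zsmul, h_eq, (hE i _ (hlt i)).1, smul_zero]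
  have h1 (i : I) (m : ℤ)
      (hm : m • h i ∈ Submodule.span ℤ (Set.range fun j : Set.Iio i => h j)) :
      (n i : ℤ) ∣ m := by
    rw [h_eq] at hm
    exact (hE i _ (hlt i)).2 m hm
  refine ⟨h, fun f => ⟨fun hf => ?_, fun hf => ?_⟩⟩
  · by_contra! hcon
    classical
    obtain ⟨i₀, hi₀⟩ := hcon
    -- At the largest index with `n i ∤ f i`, all later terms vanish, so `f i • h i` lies in the
    -- span of the earlier elements, contradicting the choice of `h i`.
    let s := f.support.filter fun i => ¬ (n i : ℤ) ∣ f i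
    have hmem (j : I) : j ∈ s ↔ ¬ (n j : ℤ) ∣ f j := by
      simp only [s, Finset.mem_filter, Finsupp.mem_support_iff, and_iff_right_iff_imp]
      intro hj h0
      exact hj (h0 ▸ dvd_zero _)
    have hs : s.Nonempty := ⟨i₀, (hmem _).2 hi₀⟩
    have hi := (hmem _).1 (s.max'_mem hs)
    set i := s.max' hs with hi_def
    refine hi (h1 i _ ?_)
    have hisupp : i ∈ f.support := (Finset.mem_filter.1 (s.max'_mem hs)).1
    rw [Finsupp.linearCombination_apply, Finsupp.sum, ← Finset.add_sum_erase _ _ hisupp,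
      add_eq_zero_iff_eq_neg] at hf
    rw [hf]
    refine Submodule.neg_mem _ (Submodule.sum_mem _ fun j hj => ?_)
    rcases lt_or_gt_of_ne (Finset.ne_of_mem_erase hj) with hji | hji
    · exact Submodule.smul_mem _ _ (Submodule.subset_span ⟨⟨j, hji⟩, rfl⟩)
    · have : (n j : ℤ) ∣ f j := by
        by_contra hj'
        exact (s.le_max' j ((hmem j).2 hj')).not_gt hji
      rw [h0 j _ this]
      exact Submodule.zero_mem _
  · rw [Finsupp.linearCombination_apply]
    exact Finset.sum_eq_zero fun i _ => h0 i _ (hf i)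

/-! ### Extension of a partial embedding -/

/-- Extension of an isomorphism between subgroups of `H` and of `Y` to an embedding of `H` into
`Y × Z`, where `Y` and `Z` are injective and `Z` contains a copy of every subgroup of `H`. -/
theorem exists_injective_extension {A : Type*} {H : Type*} {Y : Type*} {Z : Type*}
    [AddCommGroup A] [AddCommGroup H] [AddCommGroup Y] [AddCommGroup Z]
    (hY : Module.Baer ℤ Y) (hZ : Module.Baer ℤ Z) (α : A →+ H) (β : A →+ Y)
    (hαβ : ∀ a, α a = 0 ↔ β a = 0)
    (hK : ∀ K : AddSubgroup H, ∃ θ : K →+ Z, Function.Injective θ) :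
    ∃ φ : H →+ Y × Z, Function.Injective φ ∧ ∀ a, φ (α a) = (β a, 0) := by
  let ψ : A ⧸ α.ker →+ Y := QuotientAddGroup.lift α.ker β fun a ha => (hαβ a).1 ha
  have hψ : ∀ q, ψ q = 0 → q = 0 := by
    intro q
    induction q using QuotientAddGroup.induction_on with
    | H a => exact fun ha => (QuotientAddGroup.eq_zero_iff a).2 ((hαβ a).2 ha)
  obtain ⟨g, hg⟩ := hY.extension_property_addMonoidHom (QuotientAddGroup.kerLift α)
    (QuotientAddGroup.kerLift_injective α) ψ
  have hg' (q) : g (QuotientAddGroup.kerLift α q) = ψ q := DFunLike.congr_fun hg q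
  obtain ⟨θ, hθ⟩ := hK g.ker
  -- As `ψ` is injective, `g` is injective on the image of `α`, so the sum of this image and `g.ker`
  -- is direct. Hence `θ'` can be prescribed as `0` on the image and `θ` on the kernel.
  obtain ⟨θ', hθ'⟩ := hZ.extension_property_addMonoidHom
    ((QuotientAddGroup.kerLift α).coprod g.ker.subtype) (by
      rw [injective_iff_map_eq_zero]
      rintro ⟨q, k⟩ hqk
      simp only [AddMonoidHom.coprod_apply, AddSubgroup.subtype_apply] at hqk
      have hq := congrArg g hqk
      rw [map_add, hg', AddMonoidHom.mem_ker.1 k.2, add_zero, map_zero] at hq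
      have hq0 := hψ q hq
      subst hq0
      rw [map_zero, zero_add] at hqk
      exact Prod.ext rfl (Subtype.ext hqk)) (θ.comp (AddMonoidHom.snd _ _))
  have hθ'' (q) (k : g.ker) : θ' (QuotientAddGroup.kerLift α q + (k : H)) = θ k :=
    DFunLike.congr_fun hθ' (q, k)
  refine ⟨g.prod θ', ?_, fun a => ?_⟩
  · rw [injective_iff_map_eq_zero]
    intro x hx
    have hx1 : g x = 0 := congrArg Prod.fst hx
    have hx2 : θ' x = 0 := congrArg Prod.snd hx
    have := hθ'' 0 ⟨x, hx1⟩
    rw [map_zero, zero_add, hx2] at this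
    exact congrArg Subtype.val ((injective_iff_map_eq_zero θ).1 hθ _ this.symm)
  · have h1 := hg' (a : A ⧸ α.ker)
    have h2 := hθ'' (a : A ⧸ α.ker) 0
    rw [AddSubgroup.coe_zero, add_zero, map_zero] at h2
    exact Prod.ext h1 h2

/-! ### Embedding groups of bounded size into divisible groups -/

theorem isSimpleModule_span_singleton_of_addOrderOf {K : Type u} [AddCommGroup K] {y : K}
    (hy : (addOrderOf y).Prime) : IsSimpleModule ℤ (Submodule.span ℤ {y}) := by
  rw [isSimpleModule_iff_quot_maximal]
  refine ⟨Ideal.torsionOf ℤ K y, ?_, ⟨(Ideal.quotTorsionOfEquivSpanSingleton ℤ K y).symm⟩⟩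
  have : Ideal.torsionOf ℤ K y = Ideal.span {(addOrderOf y : ℤ)} := by
    ext m
    rw [Ideal.mem_torsionOf_iff, Ideal.mem_span_singleton, addOrderOf_dvd_iff_zsmul_eq_zero]
  rw [this]
  exact PrincipalIdealRing.isMaximal_of_irreducible (Nat.prime_iff_prime_int.1 hy).irreducible

/-- The socle is a direct sum of at most `#K` simple groups, each embedding in `ℚ/ℤ` by a nonzero
character. The resulting embedding extends to `K`, and it detects torsion because every nonzero
torsion element has a multiple of prime order, which lies in the socle. -/
theorem exists_hom_finsupp_qmodZ {K : Type u} [AddCommGroup K] {R : Type v}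
    (hR : Cardinal.lift.{v} #K ≤ Cardinal.lift.{u} #R) :
    ∃ f : K →+ (R →₀ QmodZ), ∀ x, IsOfFinAddOrder x → f x = 0 → x = 0 := by
  classical
  let soc : Submodule ℤ K := ⨆ m ∈ {m : Submodule ℤ K | IsSimpleModule ℤ m}, m
  have : IsSemisimpleModule ℤ soc := isSemisimpleModule_biSup_of_isSemisimpleModule_submodule
    fun m (hm : IsSimpleModule ℤ m) => inferInstance
  obtain ⟨s, e, -, hs⟩ := IsSemisimpleModule.exists_linearEquiv_dfinsupp ℤ soc
  have hne (m : s) : ∃ x : m.1, x ≠ 0 := by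
    have := hs m
    have := IsSimpleModule.nontrivial ℤ m.1
    exact exists_ne 0
  choose t ht using hne
  have hsK : #s ≤ #K := by
    refine Cardinal.mk_le_of_injective (f := fun m : s => (e.symm (DFinsupp.single m (t m)) : K)) ?_
    intro m m' hmm
    have := e.symm.injective (Subtype.ext hmm)
    rcases DFinsupp.single_eq_single_iff _ _ _ _ |>.1 this with h | h
    · exact h.1
    · exact absurd h.1 (ht m)
  obtain ⟨ι⟩ := Cardinal.lift_mk_le'.1 ((Cardinal.lift_le.2 hsK).trans hR)
  have hχ (m : s) : ∃ c : m.1 →+ QmodZ, Function.Injective c := by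
    have := hs m
    obtain ⟨c, hc⟩ := CharacterModule.exists_character_apply_ne_zero_of_ne_zero (ht m)
    refine ⟨c, LinearMap.injective_of_ne_zero (f := AddMonoidHom.toIntLinearMap c) ?_⟩
    intro h
    exact hc (DFunLike.congr_fun h (t m))
  choose c hc using hχ
  let g : soc →+ (R →₀ QmodZ) :=
    (Finsupp.mapDomain.addMonoidHom ι).comp
      ((finsuppAddEquivDFinsupp (ι := s) (M := QmodZ)).symm.toAddMonoidHom.comp
        ((DFinsupp.mapRange.addMonoidHom c).comp e.toAddEquiv.toAddMonoidHom))
  have hg : Function.Injective g :=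
    (Finsupp.mapDomain_injective ι.injective).comp
      ((AddEquiv.injective (finsuppAddEquivDFinsupp (ι := s) (M := QmodZ)).symm).comp
        (((DFinsupp.mapRange_injective _ fun m => map_zero _).2 hc).comp e.injective))
  obtain ⟨f, hf⟩ := (baer_finsupp_qmodZ R).extension_property_addMonoidHom soc.subtype.toAddMonoidHom
    Subtype.val_injective g
  refine ⟨f, fun x hx hfx => ?_⟩
  by_contra hx0
  have h1 : addOrderOf x ≠ 1 := fun h => hx0 (AddMonoid.addOrderOf_eq_one_iff.1 h)
  obtain ⟨p, hp, k, hk⟩ := Nat.exists_prime_and_dvd h1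
  have hpos := hx.addOrderOf_pos
  have hk0 : k ≠ 0 := by rintro rfl; simp [hk] at hpos
  have hy : addOrderOf (k • x) = p := by
    rw [addOrderOf_nsmul' x hk0, hk, Nat.gcd_eq_right (dvd_mul_left _ _),
      Nat.mul_div_cancel _ (Nat.pos_of_ne_zero hk0)]
  have hmem : k • x ∈ soc :=
    Submodule.mem_iSup_of_mem (Submodule.span ℤ {k • x}) (Submodule.mem_iSup_of_mem
      (isSimpleModule_span_singleton_of_addOrderOf (hy ▸ hp)) (Submodule.mem_span_singleton_self _))
  have hgy : g ⟨k • x, hmem⟩ = 0 := by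
    rw [← hf]
    change f (k • x) = 0
    rw [map_nsmul, hfx, smul_zero]
  have hy0 : k • x = 0 := congrArg Subtype.val ((injective_iff_map_eq_zero g).1 hg _ hgy)
  rw [hy0, addOrderOf_zero] at hy
  exact hp.one_lt.ne hy

-- The kernel of `K → ℚ ⊗ K` is the torsion of `K`, and the dimension of `ℚ ⊗ K` is at most `#K`.
open TensorProduct in
theorem exists_hom_finsupp_rat {K : Type u} [AddCommGroup K] {R : Type v}
    (hR : Cardinal.lift.{v} #K ≤ Cardinal.lift.{u} #R) :
    ∃ f : K →+ (R →₀ ℚ), ∀ x, f x = 0 → IsOfFinAddOrder x := by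
  let b := Module.Basis.ofVectorSpace ℚ (ℚ ⊗[ℤ] K)
  have hb : #(Module.Basis.ofVectorSpaceIndex ℚ (ℚ ⊗[ℤ] K)) ≤ #K := by
    have hspan : Submodule.span ℚ (Set.range fun k : K => (1 : ℚ) ⊗ₜ[ℤ] k) = ⊤ := by
      refine top_le_iff.1 fun x _ => ?_
      induction x with
      | zero => exact Submodule.zero_mem _
      | add x y hx hy => exact Submodule.add_mem _ (hx trivial) (hy trivial)
      | tmul q k =>
        rw [← mul_one q, ← smul_eq_mul, ← TensorProduct.smul_tmul']
        exact Submodule.smul_mem _ _ (Submodule.subset_span ⟨k, rfl⟩)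
    rw [b.mk_eq_rank'', ← rank_top ℚ (ℚ ⊗[ℤ] K), ← hspan]
    exact (rank_span_le _).trans Cardinal.mk_range_le
  obtain ⟨ι⟩ := Cardinal.lift_mk_le'.1 ((Cardinal.lift_le.2 hb).trans hR)
  let f : K →+ (R →₀ ℚ) := (Finsupp.mapDomain.addMonoidHom ι).comp
    (b.repr.toAddEquiv.toAddMonoidHom.comp (TensorProduct.mk ℤ ℚ K 1).toAddMonoidHom)
  refine ⟨f, fun x hx => ?_⟩
  have h1 : b.repr ((1 : ℚ) ⊗ₜ[ℤ] x) = 0 :=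
    Finsupp.mapDomain_injective ι.injective (hx.trans (Finsupp.mapDomain_zero).symm)
  have h2 : TensorProduct.mk ℤ ℚ K 1 x = 0 := by simpa using h1
  obtain ⟨c, hc⟩ := (IsLocalizedModule.eq_zero_iff (nonZeroDivisors ℤ) _).1 h2
  exact isOfFinAddOrder_iff_zsmul_eq_zero.2 ⟨c, nonZeroDivisors.ne_zero c.2, hc⟩

theorem exists_embedding_finsupp_prod {K : Type u} [AddCommGroup K] {R R' : Type v}
    (hR : Cardinal.lift.{v} #K ≤ Cardinal.lift.{u} #R)
    (hR' : Cardinal.lift.{v} #K ≤ Cardinal.lift.{u} #R') :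
    ∃ f : K →+ (R →₀ QmodZ) × (R' →₀ ℚ), Function.Injective f := by
  obtain ⟨f, hf⟩ := exists_hom_finsupp_qmodZ hR
  obtain ⟨g, hg⟩ := exists_hom_finsupp_rat hR'
  refine ⟨f.prod g, (injective_iff_map_eq_zero _).2 fun x hx => ?_⟩
  exact hf x (hg x (congrArg Prod.snd hx)) (congrArg Prod.fst hx)

/-- Since `ZMod 0 = ℤ`, this puts infinite order on the same footing as the finite orders in
`exists_independent_family`. -/
theorem exists_injective_of_continuum_le_rank {H : Type u} [AddCommGroup H]
    (h : continuum ≤ Module.rank ℤ H) :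
    ∃ f : (ℝ →₀ ZMod 0) →+ H, Function.Injective f := by
  obtain ⟨s, hs, hli⟩ := exists_set_linearIndependent_of_isDomain ℤ H
  have : Cardinal.lift.{u} #ℝ ≤ Cardinal.lift.{0} #s := by
    simpa [hs, Cardinal.mk_real] using h
  obtain ⟨ι⟩ := Cardinal.lift_mk_le'.1 this
  have := hli.comp ι ι.injective
  exact ⟨(Finsupp.linearCombination ℤ _).toAddMonoidHom, this⟩

/-! ### Coordinates and generators in `𝐗` -/

namespace IndexData

variable (S : IndexData)

theorem bracket_chiOne (μ : S.P₁) :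
    S.bracket (S.chiOne μ) = (0, Finsupp.single μ 1, 0, 0) := by
  simp [bracket, chiOne]

theorem bracket_smul_chiZero (q : ℚ) (μ : S.P₀) (i : ℕ) :
    S.bracket (q • S.chiZero μ i) = (Finsupp.single (μ, i) (q : QmodZ), 0, 0, 0) := by
  simp [bracket, chiZero]

/-- The embedding into `𝐗` which sends the coordinate `μ ∈ P₀` to the coordinate `(μ, 0)`. -/
noncomputable def zerothColumn :
    ((S.P₀ →₀ QmodZ) × (S.P₁ →₀ ℚ)) × ((S.R₀ →₀ QmodZ) × (S.R₁ →₀ ℚ)) →+ S.X :=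
  AddMonoidHom.codRestrict
    (((Finsupp.mapDomain.addMonoidHom fun μ : S.P₀ => (μ, 0)).prodMap
      (AddMonoidHom.id ((S.P₁ →₀ ℚ) × (S.R₀ →₀ QmodZ) × (S.R₁ →₀ ℚ)))).comp
        (AddEquiv.prodAssoc).toAddMonoidHom) S.X (by
    rintro ⟨⟨a, b⟩, c⟩ ⟨μ, i⟩ hx
    have hmem := Finsupp.mapDomain_support (Finsupp.mem_support_iff.2 hx)
    obtain ⟨ν, -, hν⟩ := Finset.mem_image.1 hmem
    obtain ⟨rfl, rfl⟩ := Prod.mk.inj hν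
    obtain ⟨n, m, hn, hm, hC⟩ := S.C_union.ge ν.2
    -- The last `hm` reads `1 ≤ m` as `0 < m`: column `0` is present over every `C n m`.
    exact ⟨n, m, hn, hm, hC, hm⟩)

theorem zerothColumn_apply (a : S.P₀ →₀ QmodZ) (b : S.P₁ →₀ ℚ) (c : S.R₀ →₀ QmodZ)
    (d : S.R₁ →₀ ℚ) :
    (S.zerothColumn ((a, b), (c, d)) : S.W) = (a.mapDomain fun μ => (μ, 0), b, c, d) :=
  rfl

theorem zerothColumn_injective : Function.Injective S.zerothColumn := by
  rintro ⟨⟨a, b⟩, c, d⟩ ⟨⟨a', b'⟩, c', d'⟩ h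
  have h' := congrArg Subtype.val h
  simp only [zerothColumn_apply, Prod.mk.injEq] at h'
  obtain ⟨h1, rfl, rfl, rfl⟩ := h'
  rw [Finsupp.mapDomain_injective (fun _ _ h => (Prod.mk.inj h).1) h1]

/-- The generators `1/n` at the coordinates in `P₀` and `1` at the coordinates in `P₁`. -/
noncomputable def generator (n : S.P₀ → ℕ) : S.P₀ ⊕ S.P₁ → (S.P₀ →₀ QmodZ) × (S.P₁ →₀ ℚ) :=
  Sum.elim (fun μ => (Finsupp.single μ ((1 / (n μ : ℚ) : ℚ) : QmodZ), 0))
    fun μ => (0, Finsupp.single μ 1)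

theorem linearCombination_generator_fst (n : S.P₀ → ℕ) (f : S.P₀ ⊕ S.P₁ →₀ ℤ) (μ : S.P₀) :
    (Finsupp.linearCombination ℤ (S.generator n) f).1 μ =
      f (Sum.inl μ) • ((1 / (n μ : ℚ) : ℚ) : QmodZ) := by
  classical
  induction f using Finsupp.induction_linear with
  | zero => simp
  | add f g hf hg => rw [map_add, Prod.fst_add, Finsupp.add_apply, hf, hg, Finsupp.add_apply,
      add_smul]
  | single i k =>
    rcases i with ν | ν
    · rw [Finsupp.linearCombination_single, Finsupp.single_apply]
      by_cases h : ν = μ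
      · subst h; simp [generator]
      · simp [generator, h]
    · simp [generator]

theorem linearCombination_generator_snd (n : S.P₀ → ℕ) (f : S.P₀ ⊕ S.P₁ →₀ ℤ) (μ : S.P₁) :
    (Finsupp.linearCombination ℤ (S.generator n) f).2 μ = f (Sum.inr μ) := by
  classical
  induction f using Finsupp.induction_linear with
  | zero => simp
  | add f g hf hg => rw [map_add, Prod.snd_add, Finsupp.add_apply, hf, hg, Finsupp.add_apply,
      Int.cast_add]
  | single i k =>
    rcases i with ν | ν
    · simp [generator]
    · rw [Finsupp.linearCombination_single, Finsupp.single_apply]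
      by_cases h : ν = μ
      · subst h; simp [generator]
      · simp [generator, h]

/-- These are exactly the relations of the independent family chosen in `H`, with `0` recording
infinite order. -/
theorem linearCombination_generator_eq_zero_iff (n : S.P₀ → ℕ) (hn : ∀ μ, n μ ≠ 0)
    (f : S.P₀ ⊕ S.P₁ →₀ ℤ) :
    Finsupp.linearCombination ℤ (S.generator n) f = 0 ↔
      ∀ i, ((Sum.elim n (fun _ => 0) i : ℕ) : ℤ) ∣ f i := by
  have hQ (μ : S.P₀) (k : ℤ) : k • ((1 / (n μ : ℚ) : ℚ) : QmodZ) = 0 ↔ (n μ : ℤ) ∣ k := by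
    have h0 : (n μ : ℚ) ≠ 0 := by exact_mod_cast hn μ
    rw [← AddCircle.coe_zsmul, AddCircle.coe_eq_zero_iff]
    simp only [zsmul_eq_mul, mul_one]
    constructor
    · rintro ⟨l, hl⟩
      refine ⟨l, ?_⟩
      field_simp at hl
      exact_mod_cast (by linarith : (k : ℚ) = n μ * l)
    · rintro ⟨l, rfl⟩
      refine ⟨l, ?_⟩
      push_cast
      field_simp
  rw [Prod.ext_iff, Finsupp.ext_iff, Finsupp.ext_iff, Sum.forall]
  refine and_congr (forall_congr' fun μ => ?_) (forall_congr' fun μ => ?_)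
  · rw [linearCombination_generator_fst]
    exact hQ μ _
  · rw [linearCombination_generator_snd]
    simp

end IndexData

/-! ### The embedding into `𝐗` -/

theorem exists_embedding_X (S : IndexData) (H : Type u) [AddCommGroup H] (hH : SizeCondition H) :
    ∃ φ : H →+ S.X, Function.Injective φ ∧
      (∀ μ : S.P₁, ∃ x ∈ φ.range, (x : S.W) = S.bracket (S.chiOne μ)) ∧
      ∀ n ∈ ordersD H, ∀ μ : S.P₀, (μ : Ordinal.{0}) ∈ S.C n 1 →
        ∃ x ∈ φ.range, (x : S.W) = S.bracket ((1 / (n : ℚ)) • S.chiZero μ 0) := by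
  classical
  obtain ⟨hcard, -, hrank⟩ := hH
  have hn (μ : S.P₀) : ∃ n : ℕ, n ≠ 0 ∧
      (∃ f : (ℝ →₀ ZMod n) →+ H, Function.Injective f) ∧
      ∀ n' ∈ ordersD H, (μ : Ordinal.{0}) ∈ S.C n' 1 → n = n' := by
    by_cases h : ∃ n ∈ ordersD H, (μ : Ordinal.{0}) ∈ S.C n 1
    · obtain ⟨n, hn, hμ⟩ := h
      refine ⟨n, (zero_lt_one.trans hn.1).ne', hn.2, fun n' hn' hμ' => ?_⟩
      by_contra hne
      exact Set.disjoint_left.1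
        (S.C_disjoint n 1 n' 1 hn.1 le_rfl hn'.1 le_rfl (by simpa using hne)) hμ hμ'
    -- Order `1` is the default where nothing is required: `ZMod 1` is trivial, and `1/1` vanishes
    -- in `ℚ/ℤ`.
    · refine ⟨1, one_ne_zero, ⟨0, ?_⟩, fun n' hn' hμ => absurd ⟨n', hn', hμ⟩ h⟩
      intro a b _
      ext i
      exact Subsingleton.elim _ _
  choose n hn0 hnH hnC using hn
  obtain ⟨h, hh⟩ := exists_independent_family (H := H)
    (Sum.elim n (fun _ : S.P₁ => 0)) (by simp [S.card_P₀, S.card_P₁]) (by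
      rintro (μ | μ)
      · exact hnH μ
      · exact exists_injective_of_continuum_le_rank hrank)
  have hsize {R : Set Ordinal.{0}} (hR : #R = 2 ^ continuum) (K : AddSubgroup H) :
      Cardinal.lift.{1} #K ≤ Cardinal.lift.{u} #R := by
    have := Cardinal.lift_le.{1}.2 ((Cardinal.mk_subtype_le (· ∈ K)).trans hcard)
    simpa [hR] using this
  obtain ⟨φ, hφ, hφβ⟩ := exists_injective_extension (baer_finsupp_qmodZ_prod S.P₀ S.P₁)
    (baer_finsupp_qmodZ_prod S.R₀ S.R₁) (Finsupp.linearCombination ℤ h).toAddMonoidHom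
    (Finsupp.linearCombination ℤ (S.generator n)).toAddMonoidHom
    (fun f => (hh f).trans (S.linearCombination_generator_eq_zero_iff n hn0 f).symm)
    (fun K => exists_embedding_finsupp_prod (hsize S.card_R₀ K) (hsize S.card_R₁ K))
  have hφh (i) : φ (h i) = (S.generator n i, 0) := by
    simpa using hφβ (Finsupp.single i 1)
  refine ⟨S.zerothColumn.comp φ, S.zerothColumn_injective.comp hφ, fun μ => ?_,
    fun n' hn' μ hμ => ?_⟩
  · refine ⟨_, ⟨h (Sum.inr μ), rfl⟩, ?_⟩
    rw [S.bracket_chiOne, AddMonoidHom.comp_apply, hφh]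
    simp [IndexData.generator, ← Prod.mk_zero_zero, S.zerothColumn_apply]
  · refine ⟨_, ⟨h (Sum.inl μ), rfl⟩, ?_⟩
    rw [S.bracket_smul_chiZero, AddMonoidHom.comp_apply, hφh]
    simp [IndexData.generator, ← Prod.mk_zero_zero, S.zerothColumn_apply, hnC μ n' hn' hμ]

/-! ### Invariance under isomorphism and the conclusion -/

theorem ordersD_congr {G : Type u} {L : Type v} [AddCommGroup G] [AddCommGroup L] (e : G ≃+ L) :
    ordersD G = ordersD L := by
  ext n
  refine and_congr_right fun _ => ⟨?_, ?_⟩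
  · rintro ⟨f, hf⟩
    exact ⟨e.toAddMonoidHom.comp f, e.injective.comp hf⟩
  · rintro ⟨f, hf⟩
    exact ⟨e.symm.toAddMonoidHom.comp f, e.symm.injective.comp hf⟩

theorem SizeCondition.congr {G : Type u} {L : Type v} [AddCommGroup G] [AddCommGroup L]
    (e : G ≃+ L) (h : SizeCondition G) : SizeCondition L := by
  have hcard := Cardinal.lift_mk_eq'.2 ⟨e.toEquiv⟩
  have hrank := e.toIntLinearEquiv.lift_rank_eq
  obtain ⟨h1, h2, h3⟩ := h
  refine ⟨?_, ?_, ?_⟩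
  · rw [← Cardinal.lift_le.{u}, ← hcard]
    simpa using Cardinal.lift_le.{v}.2 h1
  · rw [← Cardinal.lift_le.{u}, ← hcard, ← hrank]
    exact Cardinal.lift_le.2 h2
  · rw [← Cardinal.continuum_le_lift.{v, u}, ← hrank]
    exact Cardinal.continuum_le_lift.2 h3

theorem TorsionCondition.congr {G : Type u} {L : Type v} [AddCommGroup G] [AddCommGroup L]
    (e : G ≃+ L) (h : TorsionCondition G) : TorsionCondition L := by
  intro d n hd hn hdn
  have himage : (fun x : L => d • x) '' {x : L | n • x = 0} =
      e '' ((fun x : G => d • x) '' {x : G | n • x = 0}) := by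
    ext y
    constructor
    · rintro ⟨x, hx, rfl⟩
      refine ⟨_, ⟨e.symm x, ?_, rfl⟩, by simp⟩
      rw [Set.mem_ofPred_eq] at hx ⊢
      rw [← map_nsmul, hx, map_zero]
    · rintro ⟨_, ⟨x, hx, rfl⟩, rfl⟩
      refine ⟨e x, ?_, by simp⟩
      rw [Set.mem_ofPred_eq] at hx ⊢
      rw [← map_nsmul, hx, map_zero]
  rw [himage]
  refine (h d n hd hn hdn).imp (fun hfin => hfin.image e) fun hc => ?_
  rw [← Cardinal.continuum_le_lift.{v, u}, Cardinal.mk_image_eq_lift _ _ e.injective]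
  exact Cardinal.continuum_le_lift.2 hc

theorem mainTheorem5 (S : IndexData) (H : Type u) [AddCommGroup H] (hH : SizeCondition H) :
    (∃ (k : ℕ → ℕ) (φ : H →+ S.X),
      (∀ n ∈ ordersD H, 1 ≤ k n) ∧
      Function.Injective φ ∧
      (∀ μ : S.P₁, (μ : Ordinal.{0}) ∈ S.C₁ →
        ∃ x ∈ φ.range, (x : S.W) = S.bracket (S.chiOne μ)) ∧
      (∀ n ∈ ordersD H, ∀ μ : S.P₀, (μ : Ordinal.{0}) ∈ S.C n (k n) →
        ∃ x ∈ φ.range, (x : S.W) = S.bracket ((1 / (n : ℚ)) • S.chiZero μ 0))) ∧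
    (TorsionCondition H →
      ∃ L : AddSubgroup S.X, S.IsLarge L ∧ Nonempty (H ≃+ L)) := by
  obtain ⟨φ, hφ, h1, h2⟩ := exists_embedding_X S H hH
  refine ⟨⟨fun _ => 1, φ, fun _ _ => le_rfl, hφ, fun μ _ => h1 μ, h2⟩, fun hT => ?_⟩
  have e : H ≃+ φ.range := AddMonoidHom.ofInjective hφ
  refine ⟨φ.range, ⟨hH.congr e, hT.congr e, fun _ => 1, fun _ _ => le_rfl, fun μ _ => h1 μ, ?_⟩,
    ⟨e⟩⟩
  rw [← ordersD_congr e]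
  exact h2
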